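/- Conventions. For a ring $A$, $A$-complexes are chain complexes $\cdots\to M_{s+1}\to M_s\to M_{s-1}\to\cdots$ of $A$-modules indexed by $s\in\mathbb Z$; $\Sigma$ is the shift, so $\mathrm H_n(\Sigma^iM)=\mathrm H_{n-i}(M)$; and $\mathrm H(M)=\bigoplus_{n\in\mathbb Z}\mathrm H_n(M)$. Put $\sup M=\sup\{i\mid M_i\ne0\}$ and $\mathrm{hsup}\,M=\sup\{i\mid \mathrm H_i(M)\ne0\}$. An $A$-complex $P$ is semi-projective if $\mathrm{Hom}_A(P,\beta)$ is a surjective quasi-isomorphism for every surjective quasi-isomorphism $\beta$ of $A$-complexes. A quasi-projective resolution of $M$ is a semi-projective $A$-complex $P$ for which there are $\ell\in\mathbb Z$ and integers $a_i\ge0$ $(i\ge\ell)$, not all zero, with $$\mathrm H_n(P)\cong\bigoplus_{i\ge\ell}\mathrm H_{n-i}(M)^{a_i}\qquad\text{for all }n\in\mathbb Z .$$ If $M$ is not exact, $\mathrm{qpd}_AM$ is the infimum of $\sup P-\mathrm{hsup}\,P$ over all quasi-projective resolutions $P$ of $M$ that are bounded above ($P_i=0$ for $i\gg0$), with $\mathrm{qpd}_AM=\infty$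 if there are none; if $M$ is exact, $\mathrm{qpd}_AM=-\infty$. Theorem. Let $R$ be a commutative ring, let $\mathbf x=x_1,\dots,x_d$ be an $R$-regular sequence, and let $M$ be a nonexact complex of $R/(\mathbf x)$-modules with bounded homology (i.e. $\mathrm H_n(M)=0$ for $|n|\gg0$). Regard $M$ also as an $R$-complex via $R\to R/(\mathbf x)$, and assume $\mathrm{qpd}_RM<\infty$. Suppose that one of the following conditions holds: (1) $R$ is von Neumann regular; (2) $\mathrm{Ext}^1_R(\mathrm H(M),\mathrm H(M))=0$, where $\mathrm H(M)$ is regarded as an $R$-module. Then $$\mathrm{qpd}_{R/(\mathbf x)}M\le\mathrm{qpd}_RM-d .$$ -/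

import Mathlib

open CategoryTheory

universe u

namespace QPD

noncomputable section

/-! ### The Hom complex of two chain complexes and semi-projective complexes -/

section HomComplex

variable {R : Type u} [Ring R]

/-- The pairs of degrees `(i, j)` with `i + n = j`, indexing the components of a homogeneous
map of degree `n`. -/
abbrev DegPair (n : ℤ) : Type := {p : ℤ × ℤ // p.1 + n = p.2}

/-- Homogeneous maps of degree `n`: the group `∏ i, Hom_R (P_i, X_{i+n})`. -/
abbrev HomDeg (P X : ChainComplex (ModuleCat.{u} R) ℤ) (n : ℤ) : Type u :=
  ∀ p : DegPair n, (P.X p.1.1 ⟶ X.X p.1.2)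

/-- The differential `f ↦ d^X f - (-1)^n f d^P` on homogeneous maps of degree `n`. It takes values
in degree `m = n - 1`; for every other `m` the formula gives zero. -/
def homD (P X : ChainComplex (ModuleCat.{u} R) ℤ) (n m : ℤ) : HomDeg P X n →+ HomDeg P X m where
  toFun f p :=
    f ⟨(p.1.1, p.1.1 + n), rfl⟩ ≫ X.d (p.1.1 + n) p.1.2 -
      n.negOnePow • (P.d p.1.1 (p.1.2 - n) ≫ f ⟨(p.1.2 - n, p.1.2), by simp⟩)
  map_zero' := by
    funext p
    simp
  map_add' f g := by
    funext p
    simp only [Pi.add_apply, Preadditive.add_comp, Preadditive.comp_add, smul_add]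
    abel

/-- The formula for the differential, with the degrees spelled out. -/
lemma homD_apply (P X : ChainComplex (ModuleCat.{u} R) ℤ) (n m : ℤ) (f : HomDeg P X n)
    (i j i' j' : ℤ) (h : i + m = j) (hj : i + n = j') (hi : i' + n = j) :
    homD P X n m f ⟨(i, j), h⟩ =
      f ⟨(i, j'), hj⟩ ≫ X.d j' j - n.negOnePow • (P.d i i' ≫ f ⟨(i', j), hi⟩) := by
  obtain rfl : i' = j - n := by omega
  subst hj
  rfl

/-- The complex `Hom_R (P, X)`. -/
def homComplex (P X : ChainComplex (ModuleCat.{u} R) ℤ) : ChainComplex AddCommGrpCat.{u} ℤ where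
  X n := AddCommGrpCat.of (HomDeg P X n)
  d n m := AddCommGrpCat.ofHom (homD P X n m)
  shape n m hnm := by
    have hnm' : ¬ m + 1 = n := hnm
    refine AddCommGrpCat.hom_ext (AddMonoidHom.ext fun f => funext ?_)
    rintro ⟨⟨i, j⟩, h⟩
    have h' : i + m = j := h
    change homD P X n m f ⟨(i, j), h⟩ = 0
    rw [homD_apply P X n m f i j (j - n) (i + n) h rfl (by omega),
      X.shape _ _ (fun hc => hnm' (by change j + 1 = i + n at hc; omega)),
      P.shape _ _ (fun hc => hnm' (by change j - n + 1 = i at hc; omega))]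
    simp
  d_comp_d' n m k hnm hmk := by
    have hnm' : m + 1 = n := hnm
    have hmk' : k + 1 = m := hmk
    refine AddCommGrpCat.hom_ext (AddMonoidHom.ext fun f => funext ?_)
    rintro ⟨⟨i, j⟩, h⟩
    have h' : i + k = j := h
    change homD P X m k (homD P X n m f) ⟨(i, j), h⟩ = 0
    rw [homD_apply P X m k _ i j (i - 1) (j + 1) h (by omega) (by omega),
      homD_apply P X n m f i (j + 1) (i - 1) (j + 2) _ (by omega) (by omega),
      homD_apply P X n m f (i - 1) j (i - 2) (j + 1) _ (by omega) (by omega)]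
    obtain rfl : n = m + 1 := hnm'.symm
    simp [Int.negOnePow_succ]

/-- The chain map `Hom_R (P, β)` induced by a chain map `β`. -/
def homComplexMap (P : ChainComplex (ModuleCat.{u} R) ℤ) {X Y : ChainComplex (ModuleCat.{u} R) ℤ}
    (β : X ⟶ Y) : homComplex P X ⟶ homComplex P Y where
  f n := AddCommGrpCat.ofHom
    { toFun := fun (f : HomDeg P X n) p => f p ≫ β.f p.1.2
      map_zero' := by funext p; simp
      map_add' := fun f g => by funext p; simp }
  comm' n m _ := by
    refine AddCommGrpCat.hom_ext (AddMonoidHom.ext fun f => funext fun p => ?_)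
    change (homD P Y n m fun q => f q ≫ β.f q.1.2) p = homD P X n m f p ≫ β.f p.1.2
    simp [homD, Preadditive.sub_comp]

/-- A chain map `β` is surjective if it is surjective in each degree. -/
def IsSurjective {C : Type*} [Category C] [Limits.HasZeroMorphisms C] {X Y : ChainComplex C ℤ}
    (β : X ⟶ Y) : Prop :=
  ∀ n : ℤ, Epi (β.f n)

/-- `P` is semi-projective if `Hom_R (P, β)` is a surjective quasi-isomorphism for every
surjective quasi-isomorphism `β`. -/
def IsSemiProjective (P : ChainComplex (ModuleCat.{u} R) ℤ) : Prop :=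
  ∀ ⦃X Y : ChainComplex (ModuleCat.{u} R) ℤ⦄ (β : X ⟶ Y), IsSurjective β → QuasiIso β →
    IsSurjective (homComplexMap P β) ∧ QuasiIso (homComplexMap P β)

end HomComplex

/-! ### Suprema, boundedness, and quasi-projective dimension -/

section Dimension

variable {R : Type u} [Ring R]

/-- `sup P = sup {i | P_i ≠ 0}`, which is `-∞` for the zero complex. -/
def csup (P : ChainComplex (ModuleCat.{u} R) ℤ) : EReal :=
  sSup {s | ∃ i : ℤ, ¬ Limits.IsZero (P.X i) ∧ s = ((i : ℝ) : EReal)}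

/-- `hsup P = sup {i | H_i(P) ≠ 0}`, which is `-∞` for an exact complex. -/
def hsup (P : ChainComplex (ModuleCat.{u} R) ℤ) : EReal :=
  sSup {s | ∃ i : ℤ, ¬ Limits.IsZero (P.homology i) ∧ s = ((i : ℝ) : EReal)}

/-- `P` is bounded above: `P_i = 0` for all large `i`. -/
def BoundedAbove (P : ChainComplex (ModuleCat.{u} R) ℤ) : Prop :=
  ∃ b : ℤ, ∀ i : ℤ, b < i → Limits.IsZero (P.X i)

/-- The homology of `M` is bounded: `H_i(M) ≠ 0` only for `i` in some finite interval. -/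
def HomologicallyBounded (M : ChainComplex (ModuleCat.{u} R) ℤ) : Prop :=
  ∃ a b : ℤ, ∀ i : ℤ, (i < a ∨ b < i) → Limits.IsZero (M.homology i)

/-- `P` is a quasi-projective resolution of `M`: it is semi-projective and there are an integer `ℓ`
and natural numbers `a_i` for `i ≥ ℓ`, not all zero, such that
`H(P) ≅ ⨁_{i ≥ ℓ} H(Σ^i M^{a_i})` as graded modules. The family `a` is extended by zero
below `ℓ`, and `H_n(Σ^i M^{a_i})` is `H_{n-i}(M)^{a_i}`. -/
def IsQuasiProjectiveResolution (P M : ChainComplex (ModuleCat.{u} R) ℤ) : Prop :=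
  IsSemiProjective P ∧
    ∃ (l : ℤ) (a : ℤ → ℕ), (∀ i, i < l → a i = 0) ∧ (∃ i, a i ≠ 0) ∧
      ∀ n : ℤ, Nonempty
        (P.homology n ≃ₗ[R] DirectSum ℤ fun i => (Fin (a i) → M.homology (n - i)))

open Classical in
/-- The quasi-projective dimension: the infimum of `sup P - hsup P` over the bounded above
quasi-projective resolutions `P` of `M` (so `∞` if there is none), and `-∞` if `M` is exact. -/
def qpd (M : ChainComplex (ModuleCat.{u} R) ℤ) : EReal :=
  if M.Acyclic then ⊥
  else sInf {s | ∃ P : ChainComplex (ModuleCat.{u} R) ℤ,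
    BoundedAbove P ∧ IsQuasiProjectiveResolution P M ∧ s = csup P - hsup P}

/-- The module `H(M) = ⨁_n H_n(M)`. -/
def totalHomology (M : ChainComplex (ModuleCat.{u} R) ℤ) : ModuleCat.{u} R :=
  ModuleCat.of R (DirectSum ℤ fun n => M.homology n)

end Dimension

/-- A complex of `S`-modules viewed as a complex of `R`-modules along `φ : R → S`. -/
def restrict {R S : Type u} [Ring R] [Ring S] (φ : R →+* S)
    (M : ChainComplex (ModuleCat.{u} S) ℤ) : ChainComplex (ModuleCat.{u} R) ℤ :=
  ((ModuleCat.restrictScalars.{u} φ).mapHomologicalComplex (ComplexShape.down ℤ)).obj M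

/-- Von Neumann regular rings. -/
def IsVonNeumannRegular (R : Type u) [Ring R] : Prop :=
  ∀ a : R, ∃ b : R, a * b * a = a

end

end QPD

-- Write `S` for a quotient of `R` by one regular element `x`, let `N` be an `S`-complex, and let
-- `P` be a bounded above quasi-projective resolution of `N` over `R`. Then `S ⊗ P` resolves `N`
-- over `S`. It is semi-projective by adjunction. The terms of `P` are projective, so `x` is regular
-- on them and `0 → P → P → S ⊗ P → 0` is exact. As `H(P)` is built from copies of `H(N)`, `x` kills
-- it, and the long exact sequence breaks into `0 → H_n(P) → H_n(S ⊗ P) → H_{n-1}(P) → 0`. Once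
-- these split, `H(S ⊗ P)` is again a sum of shifts of `H(N)`. Base change does not raise `sup` and
-- raises `hsup` by at least one, so `qpd` drops by at least one; induction on `d` follows.
--
-- Splitting comes from the vanishing of Ext: the outer terms are retracts of finite sums of the
-- `H_i(N)`, homology being bounded. Over a von Neumann regular ring a regular sequence is empty, so
-- only `d = 0` occurs.

universe w

namespace QPD

noncomputable section

open Limits

/-! ### Base change of semi-projective complexes. -/

section BaseChange

variable {R S : Type u} [CommRing R] [CommRing S] (φ : R →+* S)

/-- Homology commutes with restriction of scalars. -/
def restrictHomologyIso (M : ChainComplex (ModuleCat.{u} S) ℤ) (n : ℤ) :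
    (restrict φ M).homology n ≅ (ModuleCat.restrictScalars.{u} φ).obj (M.homology n) :=
  (M.sc n).mapHomologyIso (ModuleCat.restrictScalars.{u} φ)

lemma isZero_restrictScalars_iff (X : ModuleCat.{u} S) :
    IsZero ((ModuleCat.restrictScalars.{u} φ).obj X) ↔ IsZero X := by
  rw [ModuleCat.isZero_iff_subsingleton, ModuleCat.isZero_iff_subsingleton]
  rfl

lemma isZero_restrict_homology_iff (M : ChainComplex (ModuleCat.{u} S) ℤ) (n : ℤ) :
    IsZero ((restrict φ M).homology n) ↔ IsZero (M.homology n) :=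
  (restrictHomologyIso φ M n).isZero_iff.trans (isZero_restrictScalars_iff φ _)

lemma restrict_acyclic_iff (M : ChainComplex (ModuleCat.{u} S) ℤ) :
    (restrict φ M).Acyclic ↔ M.Acyclic := by
  simp only [HomologicalComplex.Acyclic, HomologicalComplex.exactAt_iff_isZero_homology,
    isZero_restrict_homology_iff]

/-- Restriction of scalars on morphisms of complexes. -/
abbrev restrictMap {X Y : ChainComplex (ModuleCat.{u} S) ℤ} (β : X ⟶ Y) :
    restrict φ X ⟶ restrict φ Y :=
  ((ModuleCat.restrictScalars.{u} φ).mapHomologicalComplex (ComplexShape.down ℤ)).map β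

instance extendScalars_additive : (ModuleCat.extendScalars.{u, u, u} φ).Additive :=
  (ModuleCat.extendRestrictScalarsAdj.{u, u, u} φ).left_adjoint_additive

/-- Extension of scalars for complexes. -/
def extend (P : ChainComplex (ModuleCat.{u} R) ℤ) : ChainComplex (ModuleCat.{u} S) ℤ :=
  ((ModuleCat.extendScalars.{u, u, u} φ).mapHomologicalComplex (ComplexShape.down ℤ)).obj P

/-- The adjunction between extension and restriction, on homogeneous maps. -/
def homDegEquiv (P : ChainComplex (ModuleCat.{u} R) ℤ) (X : ChainComplex (ModuleCat.{u} S) ℤ)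
    (n : ℤ) : HomDeg (extend φ P) X n ≃+ HomDeg P (restrict φ X) n :=
  AddEquiv.piCongrRight fun p =>
    (ModuleCat.extendRestrictScalarsAdj.{u, u, u} φ).homAddEquiv (P.X p.1.1) (X.X p.1.2)

lemma homDegEquiv_homD (P : ChainComplex (ModuleCat.{u} R) ℤ)
    (X : ChainComplex (ModuleCat.{u} S) ℤ) (n m : ℤ) (f : HomDeg (extend φ P) X n) :
    homDegEquiv φ P X m (homD (extend φ P) X n m f) =
      homD P (restrict φ X) n m (homDegEquiv φ P X n f) := by
  funext p
  have hs : ∀ (k : ℤˣ) {A : ModuleCat.{u} R} {B : ModuleCat.{u} S}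
      (g : (ModuleCat.extendScalars.{u, u, u} φ).obj A ⟶ B),
      (ModuleCat.extendRestrictScalarsAdj.{u, u, u} φ).homAddEquiv A B (k • g) =
        k • (ModuleCat.extendRestrictScalarsAdj.{u, u, u} φ).homAddEquiv A B g := by
    intro k A B g
    simp only [Units.smul_def, map_zsmul]
  refine (map_sub ((ModuleCat.extendRestrictScalarsAdj.{u, u, u} φ).homAddEquiv (P.X p.1.1) (X.X p.1.2))
    _ _).trans ?_
  refine congrArg₂ (· - ·) ?_ ((hs _ _).trans (congrArg (n.negOnePow • ·) ?_))
  · exact (ModuleCat.extendRestrictScalarsAdj.{u, u, u} φ).homEquiv_naturality_right _ _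
  · exact (ModuleCat.extendRestrictScalarsAdj.{u, u, u} φ).homEquiv_naturality_left _ _

/-- The isomorphism `Hom_S (S ⊗ P, X) ≅ Hom_R (P, X)`. -/
def homComplexIso (P : ChainComplex (ModuleCat.{u} R) ℤ)
    (X : ChainComplex (ModuleCat.{u} S) ℤ) :
    homComplex (extend φ P) X ≅ homComplex P (restrict φ X) :=
  HomologicalComplex.Hom.isoOfComponents
    (fun n => AddEquiv.toAddCommGrpIso (X := AddCommGrpCat.of (HomDeg (extend φ P) X n))
      (Y := AddCommGrpCat.of (HomDeg P (restrict φ X) n)) (homDegEquiv φ P X n))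
    (fun n m _ => by
      refine AddCommGrpCat.hom_ext (AddMonoidHom.ext fun (f : HomDeg (extend φ P) X n) => ?_)
      change homD P (restrict φ X) n m (homDegEquiv φ P X n f) =
        homDegEquiv φ P X m (homD (extend φ P) X n m f)
      rw [homDegEquiv_homD])

/-- Naturality of `homComplexIso`. -/
def homComplexArrowIso (P : ChainComplex (ModuleCat.{u} R) ℤ)
    {X Y : ChainComplex (ModuleCat.{u} S) ℤ} (β : X ⟶ Y) :
    Arrow.mk (homComplexMap (extend φ P) β) ≅ Arrow.mk (homComplexMap P (restrictMap φ β)) :=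
  Arrow.isoMk (homComplexIso φ P X) (homComplexIso φ P Y) (by
    ext n : 1
    refine AddCommGrpCat.hom_ext (AddMonoidHom.ext fun f => funext fun p => ?_)
    exact ((ModuleCat.extendRestrictScalarsAdj.{u, u, u} φ).homEquiv_naturality_right _ _).symm)

lemma isSurjective_of_arrow_iso {C : Type*} [Category C] [HasZeroMorphisms C]
    {X Y X' Y' : ChainComplex C ℤ} {f : X ⟶ Y} {g : X' ⟶ Y'} (e : Arrow.mk f ≅ Arrow.mk g)
    (hg : IsSurjective g) : IsSurjective f := by
  intro n
  have e' := (HomologicalComplex.eval C (ComplexShape.down ℤ) n).mapArrow.mapIso e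
  exact ((MorphismProperty.epimorphisms C).arrow_mk_iso_iff e').2 (hg n)

lemma isSurjective_restrictMap {X Y : ChainComplex (ModuleCat.{u} S) ℤ} {β : X ⟶ Y}
    (hβ : IsSurjective β) : IsSurjective (restrictMap φ β) := fun n =>
  have := hβ n
  inferInstanceAs (Epi ((ModuleCat.restrictScalars.{u} φ).map (β.f n)))

lemma quasiIso_restrictMap {X Y : ChainComplex (ModuleCat.{u} S) ℤ} {β : X ⟶ Y}
    (hβ : QuasiIso β) : QuasiIso (restrictMap φ β) :=
  inferInstanceAs (QuasiIso
    (((ModuleCat.restrictScalars.{u} φ).mapHomologicalComplex (ComplexShape.down ℤ)).map β))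

/-- By adjunction `Hom_S (S ⊗ P, β)` is `Hom_R (P, β)`, and restriction of scalars preserves
surjective quasi-isomorphisms. -/
lemma IsSemiProjective.extend {P : ChainComplex (ModuleCat.{u} R) ℤ} (hP : IsSemiProjective P) :
    IsSemiProjective (extend φ P) := by
  intro X Y β hs hq
  obtain ⟨h₁, h₂⟩ := hP (restrictMap φ β) (isSurjective_restrictMap φ hs)
    (quasiIso_restrictMap φ hq)
  refine ⟨isSurjective_of_arrow_iso (homComplexArrowIso φ P β) h₁, ?_⟩
  exact (quasiIso_iff_of_arrow_mk_iso _ _ (homComplexArrowIso φ P β)).2 h₂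

end BaseChange

/-! ### Semi-projective complexes have projective terms. -/

section Projective

variable {R : Type u} [Ring R]

/-- The contractible complex with `A × A` in every degree. -/
def contractible (A : ModuleCat.{u} R) : ChainComplex (ModuleCat.{u} R) ℤ where
  X _ := ModuleCat.of R (A × A)
  d i j := if j + 1 = i then ModuleCat.ofHom (LinearMap.inl R A A ∘ₗ LinearMap.snd R A A) else 0
  shape _ _ h := if_neg h
  d_comp_d' i j k hij hjk := by
    rw [if_pos (by exact hij), if_pos (by exact hjk)]
    rfl

lemma contractible_acyclic (A : ModuleCat.{u} R) : (contractible A).Acyclic := by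
  intro n
  rw [HomologicalComplex.exactAt_iff' _ (n + 1) n (n - 1) (by simp) (by simp)]
  rw [ShortComplex.moduleCat_exact_iff]
  intro x hx
  have h₁ : (contractible A).d n (n - 1) =
      ModuleCat.ofHom (LinearMap.inl R A A ∘ₗ LinearMap.snd R A A) := if_pos (by omega)
  have h₂ : (contractible A).d (n + 1) n =
      ModuleCat.ofHom (LinearMap.inl R A A ∘ₗ LinearMap.snd R A A) := if_pos rfl
  change (contractible A).d n (n - 1) x = 0 at hx
  change ∃ y, (contractible A).d (n + 1) n y = x
  rw [h₁] at hx
  rw [h₂]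
  obtain ⟨a, b⟩ := (x : A × A)
  have hb : b = 0 := congrArg Prod.fst hx
  subst hb
  exact ⟨((0 : A), a), rfl⟩

/-- The map of contractible complexes induced by a linear map. -/
def contractibleMap {A B : ModuleCat.{u} R} (g : A ⟶ B) : contractible A ⟶ contractible B where
  f _ := ModuleCat.ofHom (g.hom.prodMap g.hom)
  comm' i j hij := by
    have h₁ : (contractible A).d i j =
      ModuleCat.ofHom (LinearMap.inl R A A ∘ₗ LinearMap.snd R A A) := if_pos hij
    have h₂ : (contractible B).d i j =
      ModuleCat.ofHom (LinearMap.inl R B B ∘ₗ LinearMap.snd R B B) := if_pos hij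
    rw [h₁, h₂]
    ext x
    exact Prod.ext rfl (map_zero g.hom).symm

/-- A surjection onto `P.X i` induces a surjection of contractible complexes, which is a
quasi-isomorphism because both are acyclic. Lifting homogeneous maps along it yields a section. -/
lemma IsSemiProjective.projective {P : ChainComplex (ModuleCat.{u} R) ℤ}
    (hP : IsSemiProjective P) (i : ℤ) : Module.Projective R (P.X i) := by
  refine Module.Projective.of_lifting_property'' fun g hg => ?_
  set A := ModuleCat.of R (P.X i →₀ R)
  set β := contractibleMap (ModuleCat.ofHom g : A ⟶ P.X i)
  have hs : IsSurjective β := fun n =>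
    (ModuleCat.epi_iff_surjective _).2 (hg.prodMap hg)
  have hq : QuasiIso β := (quasiIso_iff β).2 fun n =>
    (quasiIsoAt_iff_exactAt β n (contractible_acyclic _ n)).2 (contractible_acyclic _ n)
  obtain ⟨h, -⟩ := hP β hs hq
  have h0 := (AddCommGrpCat.epi_iff_surjective _).1 (h 0)
  -- An element of the Hom complex need not commute with differentials, so the inclusion of `P.X i`
  -- in the single degree `i` is allowed.
  let y : HomDeg P (contractible (P.X i)) 0 := fun p =>
    if hp : p.1.1 = i then
      ModuleCat.ofHom (LinearMap.inl R (P.X i) (P.X i) ∘ₗ (eqToHom (congrArg P.X hp)).hom)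
    else 0
  obtain ⟨f, hf⟩ := h0 y
  have hfi := congrFun hf ⟨(i, i), by simp⟩
  replace hfi : f ⟨(i, i), by simp⟩ ≫ ModuleCat.ofHom (g.prodMap g) =
    y ⟨(i, i), by simp⟩ := hfi
  refine ⟨LinearMap.fst R A A ∘ₗ (f ⟨(i, i), by simp⟩).hom, LinearMap.ext fun x => ?_⟩
  have hx := congrArg (fun t : P.X i ⟶ ModuleCat.of R (P.X i × P.X i) => (t.hom x).1) hfi
  exact hx.trans (by simp [y])

end Projective

/-! ### The short exact sequence of multiplication by a regular element. -/

section Koszul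

variable {R S : Type u} [CommRing R] [CommRing S] (φ : R →+* S)

/-- The unit `P ⟶ S ⊗ P` of the base change adjunction. -/
def extendUnit (P : ChainComplex (ModuleCat.{u} R) ℤ) : P ⟶ restrict φ (extend φ P) where
  f n := (ModuleCat.extendRestrictScalarsAdj.{u, u, u} φ).unit.app (P.X n)
  comm' i j _ :=
    ((ModuleCat.extendRestrictScalarsAdj.{u, u, u} φ).unit.naturality (P.d i j)).symm

lemma extendScalars_unit_surjective (hφ : Function.Surjective φ) (A : ModuleCat.{u} R) :
    Function.Surjective ((ModuleCat.extendRestrictScalarsAdj.{u, u, u} φ).unit.app A) := by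
  let _ := φ.toAlgebra
  intro t
  change TensorProduct R S A at t
  change ∃ a : A, (1 : S) ⊗ₜ[R] a = t
  induction t with
  | zero => exact ⟨0, TensorProduct.tmul_zero _ _⟩
  | tmul s a =>
    obtain ⟨r, rfl⟩ := hφ s
    refine ⟨r • a, ?_⟩
    rw [← TensorProduct.smul_tmul, Algebra.smul_def, mul_one]
    rfl
  | add t₁ t₂ h₁ h₂ =>
    obtain ⟨a₁, rfl⟩ := h₁
    obtain ⟨a₂, rfl⟩ := h₂
    exact ⟨a₁ + a₂, TensorProduct.tmul_add _ _ _⟩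

/-- Tensoring the right exact sequence `R → R → S → 0`, with first map multiplication by `x`, with
`A` identifies the kernel of `A → S ⊗ A` with `xA`. -/
lemma extendScalars_unit_eq_zero_iff (hφ : Function.Surjective φ) {x : R}
    (hx : RingHom.ker φ = Ideal.span {x}) (A : ModuleCat.{u} R) (a : A) :
    (ModuleCat.extendRestrictScalarsAdj.{u, u, u} φ).unit.app A a = 0 ↔ ∃ b : A, x • b = a := by
  let _ := φ.toAlgebra
  have hex : Function.Exact (LinearMap.lsmul R R x) (Algebra.linearMap R S) := fun r => by
    change r ∈ RingHom.ker φ ↔ _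
    rw [hx, Ideal.mem_span_singleton']
    simp [mul_comm]
  have h := rTensor_exact A hex (show Function.Surjective (Algebra.linearMap R S) from hφ)
  change (1 : S) ⊗ₜ[R] a = 0 ↔ _
  have h1 := h (1 ⊗ₜ a)
  rw [LinearMap.rTensor_tmul, Algebra.linearMap_apply, map_one] at h1
  rw [h1]
  constructor
  · rintro ⟨y, hy⟩
    obtain ⟨b, rfl⟩ := (TensorProduct.lid R A).symm.surjective y
    refine ⟨b, ?_⟩
    simpa using congrArg (TensorProduct.lid R A) hy
  · rintro ⟨b, rfl⟩
    exact ⟨1 ⊗ₜ b, by simp [TensorProduct.smul_tmul']⟩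

lemma extendScalars_unit_bijective (hφ : Function.Bijective φ) (A : ModuleCat.{u} R) :
    Function.Bijective ((ModuleCat.extendRestrictScalarsAdj.{u, u, u} φ).unit.app A) := by
  refine ⟨(injective_iff_map_eq_zero _).2 fun a ha => ?_, extendScalars_unit_surjective φ hφ.2 A⟩
  obtain ⟨b, rfl⟩ := (extendScalars_unit_eq_zero_iff φ hφ.2 (x := 0)
    (by simpa using (RingHom.injective_iff_ker_eq_bot φ).1 hφ.1) A a).1 ha
  exact zero_smul R b

lemma isIso_extendUnit (hφ : Function.Bijective φ) (P : ChainComplex (ModuleCat.{u} R) ℤ) :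
    IsIso (extendUnit φ P) := by
  have (n : ℤ) : IsIso ((extendUnit φ P).f n) :=
    (ConcreteCategory.isIso_iff_bijective _).2 (extendScalars_unit_bijective φ hφ _)
  exact HomologicalComplex.Hom.isIso_of_components _

/-- The sequence `P ⟶ P ⟶ S ⊗ P` whose first map is multiplication by `x`. -/
def mulShortComplex (x : R) (hx : φ x = 0) (P : ChainComplex (ModuleCat.{u} R) ℤ) :
    ShortComplex (ChainComplex (ModuleCat.{u} R) ℤ) :=
  ShortComplex.mk (x • 𝟙 P) (extendUnit φ P) (by
    ext n a
    have h : x • (extendUnit φ P).f n a = 0 := by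
      change φ x • (show (extend φ P).X n from (extendUnit φ P).f n a) = 0
      rw [hx, zero_smul]
    refine Eq.trans ?_ h
    exact map_smul ((extendUnit φ P).f n).hom x a)

/-- Projective terms are flat, so `x` stays regular on them; this gives injectivity on the left. -/
lemma mulShortComplex_shortExact (hφ : Function.Surjective φ) {x : R}
    (hx : RingHom.ker φ = Ideal.span {x}) (hreg : IsSMulRegular R x)
    (hx0 : φ x = 0) {P : ChainComplex (ModuleCat.{u} R) ℤ} (hP : IsSemiProjective P) :
    (mulShortComplex φ x hx0 P).ShortExact := by
  refine HomologicalComplex.shortExact_of_degreewise_shortExact _ fun n => ?_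
  have := hP.projective n
  have := Module.Flat.of_projective (R := R) (M := P.X n)
  have hr : IsSMulRegular (P.X n) x := Module.Flat.isSMulRegular_of_nonZeroDivisors
    (mem_nonZeroDivisors_iff_right.2 fun y hy =>
      hreg.right_eq_zero_of_smul ((mul_comm x y).trans hy))
  refine { exact := ?_, mono_f := ?_, epi_g := ?_ }
  · rw [ShortComplex.moduleCat_exact_iff]
    intro a ha
    exact (extendScalars_unit_eq_zero_iff φ hφ hx (P.X n) a).1 ha
  · exact (ModuleCat.mono_iff_injective _).2 hr
  · exact (ModuleCat.epi_iff_surjective _).2 (extendScalars_unit_surjective φ hφ (P.X n))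

/-- The sequence `H_n(P) ⟶ H_n(S ⊗ P) ⟶ H_{n-1}(P)`. -/
def homologyShortComplex {x : R} {hx : φ x = 0} {P : ChainComplex (ModuleCat.{u} R) ℤ}
    (h : (mulShortComplex φ x hx P).ShortExact) (n : ℤ) : ShortComplex (ModuleCat.{u} R) :=
  ShortComplex.mk (X₁ := P.homology n) (X₂ := (restrict φ (extend φ P)).homology n)
    (X₃ := P.homology (n - 1)) (HomologicalComplex.homologyMap (extendUnit φ P) n)
    (h.δ n (n - 1) (sub_add_cancel n 1)) (h.comp_δ _ _ _)

/-- Multiplication by `x` induces zero on homology, so the long exact sequence breaks into short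
ones. -/
lemma homologyShortComplex_shortExact {x : R} {hx : φ x = 0}
    {P : ChainComplex (ModuleCat.{u} R) ℤ} (h : (mulShortComplex φ x hx P).ShortExact)
    (h0 : ∀ (n : ℤ) (a : P.homology n), x • a = 0) (n : ℤ) :
    (homologyShortComplex φ h n).ShortExact := by
  have hz (n : ℤ) : HomologicalComplex.homologyMap (mulShortComplex φ x hx P).f n = 0 := by
    change ShortComplex.homologyMap (x • 𝟙 (P.sc n)) = 0
    rw [ShortComplex.homologyMap_smul, ShortComplex.homologyMap_id]
    ext a
    exact h0 n a
  refine { exact := h.homology_exact₃ n (n - 1) (sub_add_cancel n 1), mono_f := ?_, epi_g := ?_ }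
  · exact (h.homology_exact₂ n).mono_g (hz n)
  · exact (h.homology_exact₁ n (n - 1) (sub_add_cancel n 1)).epi_f (hz (n - 1))

end Koszul

/-! ### Bookkeeping for graded sums of shifts. -/

section GradedSum

variable {R : Type u} [Ring R]

/-- The module `⨁ i, V_{n - i} ^ {a_i}`. -/
abbrev gradedSum (V : ℤ → ModuleCat.{u} R) (a : ℤ → ℕ) (n : ℤ) : ModuleCat.{u} R :=
  ModuleCat.of R (DirectSum ℤ fun i => (Fin (a i) → V (n - i)))

/-- The homology of a complex as a family of modules. -/
abbrev gradedHomology (M : ChainComplex (ModuleCat.{u} R) ℤ) (i : ℤ) : ModuleCat.{u} R :=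
  M.homology i

/-- Isomorphic families have isomorphic graded sums. -/
def gradedSumCongr {V W : ℤ → ModuleCat.{u} R} (e : ∀ i, V i ≅ W i) (a : ℤ → ℕ) (n : ℤ) :
    gradedSum V a n ≅ gradedSum W a n :=
  (DFinsupp.mapRange.linearEquiv fun i =>
    LinearEquiv.piCongrRight fun _ : Fin (a i) => (e (n - i)).toLinearEquiv).toModuleIso

/-- Direct sums commute with binary products. -/
def directSumProdEquiv (A B : ℤ → Type u) [∀ i, AddCommGroup (A i)] [∀ i, AddCommGroup (B i)]
    [∀ i, Module R (A i)] [∀ i, Module R (B i)] :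
    ((DirectSum ℤ A) × (DirectSum ℤ B)) ≃ₗ[R] DirectSum ℤ fun i => A i × B i :=
  LinearEquiv.ofLinearMap
    ((DirectSum.lmap fun i => LinearMap.inl R (A i) (B i)).coprod
      (DirectSum.lmap fun i => LinearMap.inr R (A i) (B i)))
    ((DirectSum.lmap fun i => LinearMap.fst R (A i) (B i)).prod
      (DirectSum.lmap fun i => LinearMap.snd R (A i) (B i)))
    (by ext i x : 4 <;> simp)
    (by ext i x : 4 <;> simp)

/-- Shifting the index of a graded sum. -/
def gradedSumShift (V : ℤ → ModuleCat.{u} R) (a : ℤ → ℕ) (n : ℤ) :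
    gradedSum V a (n - 1) ≃ₗ[R] DirectSum ℤ fun i => (Fin (a (i - 1)) → V (n - i)) :=
  (DirectSum.lequivCongrLeft R (Equiv.addRight (1 : ℤ))).trans
    (DFinsupp.mapRange.linearEquiv fun i =>
      LinearEquiv.piCongrRight fun _ : Fin (a (i - 1)) =>
        (eqToIso (congrArg V (show n - 1 - (i - 1) = n - i by omega))).toLinearEquiv)

/-- The sum of a graded sum and its shift. -/
def gradedSumProd (V : ℤ → ModuleCat.{u} R) (a : ℤ → ℕ) (n : ℤ) :
    (gradedSum V a n × gradedSum V a (n - 1)) ≃ₗ[R]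
      gradedSum V (fun i => a i + a (i - 1)) n :=
  ((LinearEquiv.refl R _).prodCongr (gradedSumShift V a n)).trans <|
    (directSumProdEquiv _ _).trans <| DFinsupp.mapRange.linearEquiv fun i =>
      (LinearEquiv.sumArrowLequivProdArrow _ _ R (V (n - i))).symm.trans
        (LinearEquiv.funCongrLeft R (V (n - i)) finSumFinEquiv.symm)

end GradedSum

/-! ### Restriction of scalars along a surjection. -/

section Restrict

variable {R S : Type u} [CommRing R] [CommRing S] (φ : R →+* S)

/-- Graded sums commute with restriction of scalars. -/
def gradedSumRestrict (V : ℤ → ModuleCat.{u} S) (a : ℤ → ℕ) (n : ℤ) :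
    (ModuleCat.restrictScalars.{u} φ).obj (gradedSum V a n) ≅
      gradedSum (fun i => (ModuleCat.restrictScalars.{u} φ).obj (V i)) a n :=
  -- Both sides have the same underlying group, with `R` acting through `φ` componentwise.
  let e : ((ModuleCat.restrictScalars.{u} φ).obj (gradedSum V a n)) ≃ₗ[R]
      gradedSum (fun i => (ModuleCat.restrictScalars.{u} φ).obj (V i)) a n :=
    { toFun := fun x => x
      invFun := fun x => x
      left_inv := fun _ => rfl
      right_inv := fun _ => rfl
      map_add' := fun _ _ => rfl
      map_smul' := fun _ _ => rfl }
  e.toModuleIso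

/-- Graded sums of homology commute with restriction of scalars. -/
def gradedSumHomologyRestrict (M : ChainComplex (ModuleCat.{u} S) ℤ) (a : ℤ → ℕ) (n : ℤ) :
    (ModuleCat.restrictScalars.{u} φ).obj (gradedSum (gradedHomology M) a n) ≅
      gradedSum (gradedHomology (restrict φ M)) a n :=
  gradedSumRestrict φ _ a n ≪≫ gradedSumCongr (fun i => (restrictHomologyIso φ M i).symm) a n

/-- Every scalar of `S` comes from `R`, so `R`-linear maps between `S`-modules are `S`-linear. -/
lemma restrictScalars_full (hφ : Function.Surjective φ) :
    (ModuleCat.restrictScalars.{u} φ).Full where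
  map_surjective {X Y} f := by
    refine ⟨ModuleCat.ofHom (X := X) (Y := Y)
      { toFun := fun x => f.hom x
        map_add' := fun x y => map_add f.hom x y
        map_smul' := fun s x => ?_ }, rfl⟩
    obtain ⟨r, rfl⟩ := hφ s
    exact f.hom.map_smul r (show (ModuleCat.restrictScalars.{u} φ).obj X from x)

end Restrict

/-! ### Splitting of extensions between homology modules. -/

section Retract

variable {R : Type u} [Ring R]

/-- `X` is a retract of a finite direct sum of homology modules of `N`. -/
def IsHomologyRetract (N : ChainComplex (ModuleCat.{u} R) ℤ) (X : ModuleCat.{u} R) : Prop :=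
  ∃ (ι : Type) (_ : Fintype ι) (n : ι → ℤ) (f : ∀ j, X ⟶ N.homology (n j))
    (g : ∀ j, N.homology (n j) ⟶ X), ∑ j, f j ≫ g j = 𝟙 X

/-- Short exact sequences whose outer terms are retracts of finite sums of homology modules
of `N` split. -/
def HomologySplits (N : ChainComplex (ModuleCat.{u} R) ℤ) : Prop :=
  ∀ T : ShortComplex (ModuleCat.{u} R), T.ShortExact → IsHomologyRetract N T.X₁ →
    IsHomologyRetract N T.X₃ → ∃ s : T.X₃ ⟶ T.X₂, s ≫ T.g = 𝟙 T.X₃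

lemma isHomologyRetract_of_iso {N : ChainComplex (ModuleCat.{u} R) ℤ}
    (hN : HomologicallyBounded N) {a : ℤ → ℕ} {n : ℤ} {X : ModuleCat.{u} R}
    (e : X ≅ gradedSum (gradedHomology N) a n) : IsHomologyRetract N X := by
  obtain ⟨l, u, hlu⟩ := hN
  -- Only these `i` satisfy `l ≤ n - i ≤ u`; all other summands vanish, so the direct sum is
  -- effectively finite.
  let s := Finset.Icc (n - u) (n - l)
  let p (j : Σ i : s, Fin (a i)) : gradedSum (gradedHomology N) a n ⟶ N.homology (n - j.1) :=
    ModuleCat.ofHom (LinearMap.proj j.2 ∘ₗ DirectSum.component R ℤ _ j.1.1)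
  let q (j : Σ i : s, Fin (a i)) : N.homology (n - j.1) ⟶ gradedSum (gradedHomology N) a n :=
    ModuleCat.ofHom (DirectSum.lof R ℤ (fun i => Fin (a i) → N.homology (n - i)) j.1.1 ∘ₗ
      LinearMap.single R (fun _ : Fin (a j.1) => N.homology (n - j.1)) j.2)
  have hpq : ∑ j, p j ≫ q j = 𝟙 _ := by
    refine ModuleCat.hom_ext (LinearMap.ext fun x => ?_)
    rw [ModuleCat.hom_sum, LinearMap.sum_apply, Fintype.sum_sigma]
    have h1 (i : s) : ∑ k, (p ⟨i, k⟩ ≫ q ⟨i, k⟩).hom x =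
        DirectSum.lof R ℤ (fun i => Fin (a i) → N.homology (n - i)) i (x i) := by
      change ∑ k, DirectSum.lof R ℤ (fun i => Fin (a i) → N.homology (n - i)) i
        (Pi.single k (x i k)) = _
      rw [← map_sum, Finset.univ_sum_single]
    rw [Finset.sum_congr rfl fun i _ => h1 i, Finset.sum_coe_sort s fun i =>
      DirectSum.lof R ℤ (fun i => Fin (a i) → N.homology (n - i)) i (x i)]
    refine DFinsupp.ext fun i => ?_
    change (∑ k ∈ s, DFinsupp.single (β := fun i => Fin (a i) → N.homology (n - i)) k (x k)) i =
      x i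
    rw [DFinsupp.finsetSum_apply]
    by_cases hi : i ∈ s
    · rw [Finset.sum_eq_single_of_mem i hi fun k _ hk => DFinsupp.single_eq_of_ne hk.symm,
        DFinsupp.single_eq_same]
    · have := ModuleCat.isZero_iff_subsingleton.1 (hlu (n - i) (by
        simp only [s, Finset.mem_Icc] at hi
        omega))
      exact Subsingleton.elim (α := Fin (a i) → N.homology (n - i)) _ _
  refine ⟨Σ i : s, Fin (a i), inferInstance, fun j => n - j.1, fun j => e.hom ≫ p j,
    fun j => q j ≫ e.inv, ?_⟩
  simp only [Category.assoc]
  rw [← Preadditive.comp_sum]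
  simp only [← Category.assoc]
  rw [← Preadditive.sum_comp]
  simp [hpq]

end Retract

/-- Restriction is exact and full, so a section found over `R` is already `S`-linear. The splitting
property thus descends along quotients without comparing Ext groups over different rings, which is
what the induction needs. -/
lemma HomologySplits.of_restrict {R S : Type u} [CommRing R] [CommRing S] {φ : R →+* S}
    (hφ : Function.Surjective φ) {N : ChainComplex (ModuleCat.{u} S) ℤ}
    (h : HomologySplits (restrict φ N)) : HomologySplits N := by
  have hr (X : ModuleCat.{u} S) (hX : IsHomologyRetract N X) :
      IsHomologyRetract (restrict φ N) ((ModuleCat.restrictScalars.{u} φ).obj X) := by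
    obtain ⟨ι, _, n, f, g, hfg⟩ := hX
    refine ⟨ι, inferInstance, n,
      fun j => (ModuleCat.restrictScalars.{u} φ).map (f j) ≫ (restrictHomologyIso φ N _).inv,
      fun j => (restrictHomologyIso φ N _).hom ≫ (ModuleCat.restrictScalars.{u} φ).map (g j), ?_⟩
    simp only [Category.assoc, Iso.inv_hom_id_assoc, ← Functor.map_comp]
    rw [← Functor.map_sum, hfg, CategoryTheory.Functor.map_id]
  intro T hT h₁ h₃
  have := restrictScalars_full φ hφ
  obtain ⟨s, hs⟩ := h (T.map (ModuleCat.restrictScalars.{u} φ)) (hT.map_of_exact _)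
    (hr _ h₁) (hr _ h₃)
  obtain ⟨t, rfl⟩ := (ModuleCat.restrictScalars.{u} φ).map_surjective s
  refine ⟨t, (ModuleCat.restrictScalars.{u} φ).map_injective ?_⟩
  rw [Functor.map_comp, CategoryTheory.Functor.map_id]
  exact hs

open Abelian in
-- The composite factors through an element of `Ext A B n`.
lemma ext_comp_eq_zero {C : Type*} [Category C] [Abelian C] [HasExt.{w} C] {A B X Y : C} {n : ℕ}
    (h : Subsingleton (Ext A B n)) (e : Ext X Y n) (f : X ⟶ A) (g : A ⟶ X) (f' : Y ⟶ B)
    (g' : B ⟶ Y) :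
    ((Ext.mk₀ (f ≫ g)).comp e (zero_add n)).comp (Ext.mk₀ (f' ≫ g')) (add_zero n) = 0 := by
  have h0 := Subsingleton.elim (((Ext.mk₀ g).comp e (zero_add n)).comp (Ext.mk₀ f')
    (add_zero n)) 0
  rw [← Ext.mk₀_comp_mk₀ f g, ← Ext.mk₀_comp_mk₀ f' g', Ext.comp_assoc_of_second_deg_zero,
    Ext.comp_assoc_of_third_deg_zero,
    ← Ext.comp_assoc ((Ext.mk₀ g).comp e (zero_add n)) (Ext.mk₀ f') (Ext.mk₀ g') (add_zero n)
      (add_zero 0) (by omega), h0, Ext.zero_comp, Ext.comp_zero]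

open Abelian in
-- Each `Ext¹(H_i, H_j)` is a retract of `Ext¹(H, H) = 0`. Expanding the identities of the outer
-- terms through homology modules writes the extension class as a sum of classes factoring through
-- these groups.
lemma homologySplits_of_subsingleton_ext {R : Type u} [Ring R]
    {N : ChainComplex (ModuleCat.{u} R) ℤ}
    (h : Subsingleton (Ext (totalHomology N) (totalHomology N) 1)) : HomologySplits N := by
  have hn (i j : ℤ) : Subsingleton (Ext (N.homology i) (N.homology j) 1) := by
    let ι (k : ℤ) : N.homology k ⟶ totalHomology N :=
      ModuleCat.ofHom (DirectSum.lof R ℤ (fun k => N.homology k) k)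
    let π (k : ℤ) : totalHomology N ⟶ N.homology k :=
      ModuleCat.ofHom (DirectSum.component R ℤ (fun k => N.homology k) k)
    have hιπ (k : ℤ) : ι k ≫ π k = 𝟙 _ :=
      ModuleCat.hom_ext (LinearMap.ext fun x => DirectSum.component.lof_self R (M := fun k => N.homology k) k x)
    have hx (x : Ext (N.homology i) (N.homology j) 1) : x = 0 := by
      simpa [hιπ] using ext_comp_eq_zero h x (ι i) (π i) (ι j) (π j)
    exact ⟨fun x y => (hx x).trans (hx y).symm⟩
  intro T hT ⟨ι₁, _, n₁, f₁, g₁, h₁⟩ ⟨ι₃, _, n₃, f₃, g₃, h₃⟩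
  have hz : hT.extClass = 0 := by
    have : hT.extClass = ((Ext.mk₀ (∑ j, f₃ j ≫ g₃ j)).comp hT.extClass (zero_add 1)).comp
        (Ext.mk₀ (∑ j, f₁ j ≫ g₁ j)) (add_zero 1) := by
      rw [h₁, h₃, Ext.mk₀_id_comp, Ext.comp_mk₀_id]
    rw [this, Ext.mk₀_sum, Ext.mk₀_sum, Ext.sum_comp, Ext.sum_comp]
    refine Finset.sum_eq_zero fun j _ => ?_
    rw [Ext.comp_sum]
    refine Finset.sum_eq_zero fun k _ => ?_
    exact ext_comp_eq_zero (hn _ _) _ _ _ _ _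
  -- The connecting map sends the identity of `T.X₃` to the extension class, which is zero, so the
  -- identity lifts along `T.g`.
  obtain ⟨s, hs⟩ := Ext.covariant_sequence_exact₃ _ hT (Ext.mk₀ (𝟙 T.X₃)) (zero_add 1)
    (by rw [hz, Ext.comp_zero])
  obtain ⟨t, rfl⟩ := (Ext.mk₀_bijective _ _).2 s
  rw [Ext.mk₀_comp_mk₀] at hs
  exact ⟨t, (Ext.mk₀_bijective _ _).1 hs⟩

/-! ### Quasi-projective dimension under change of rings. -/

lemma ereal_le_sub_one_iff {a b : EReal} : a ≤ b - 1 ↔ a + 1 ≤ b :=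
  EReal.le_sub_iff_add_le (.inl (EReal.coe_ne_bot 1)) (.inl (EReal.coe_ne_top 1))

lemma ereal_sub_add_coe (a b : EReal) (r : ℝ) : a - (b + r) = a - b - r := by
  rw [sub_eq_add_neg, EReal.neg_add (.inr (EReal.coe_ne_top r)) (.inr (EReal.coe_ne_bot r))]
  simp only [sub_eq_add_neg, add_assoc]

section ChangeOfRings

variable {R S : Type u} [CommRing R] [CommRing S] {φ : R →+* S}

lemma HomologicallyBounded.restrict {M : ChainComplex (ModuleCat.{u} S) ℤ}
    (h : HomologicallyBounded M) : HomologicallyBounded (restrict φ M) := by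
  obtain ⟨a, b, hab⟩ := h
  exact ⟨a, b, fun i hi => (isZero_restrict_homology_iff φ M i).2 (hab i hi)⟩

lemma isZero_extend_X {P : ChainComplex (ModuleCat.{u} R) ℤ} {i : ℤ} (h : IsZero (P.X i)) :
    IsZero ((extend φ P).X i) :=
  (ModuleCat.extendScalars.{u, u, u} φ).map_isZero h

lemma BoundedAbove.extend {P : ChainComplex (ModuleCat.{u} R) ℤ} (h : BoundedAbove P) :
    BoundedAbove (extend φ P) := by
  obtain ⟨b, hb⟩ := h
  exact ⟨b, fun i hi => isZero_extend_X (hb i hi)⟩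

lemma csup_extend_le (P : ChainComplex (ModuleCat.{u} R) ℤ) : csup (extend φ P) ≤ csup P := by
  refine sSup_le_sSup ?_
  rintro s ⟨i, hi, rfl⟩
  exact ⟨i, fun h => hi (isZero_extend_X h), rfl⟩

/-- The homology of `S ⊗ P`, computed after restriction to `R`, determines its `S`-structure. -/
lemma homology_extend_equiv (hφ : Function.Surjective φ) {P : ChainComplex (ModuleCat.{u} R) ℤ}
    {N : ChainComplex (ModuleCat.{u} S) ℤ} {a : ℤ → ℕ} {n : ℤ}
    (e : (restrict φ (extend φ P)).homology n ≅ gradedSum (gradedHomology (restrict φ N)) a n) :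
    Nonempty ((extend φ P).homology n ≃ₗ[S]
      DirectSum ℤ fun i => (Fin (a i) → N.homology (n - i))) := by
  have := restrictScalars_full φ hφ
  exact ⟨((ModuleCat.restrictScalars.{u} φ).preimageIso ((restrictHomologyIso φ _ n).symm ≪≫
    e ≪≫ (gradedSumHomologyRestrict φ N a n).symm)).toLinearEquiv⟩

lemma hsup_add_one_le {P : ChainComplex (ModuleCat.{u} R) ℤ}
    {Q : ChainComplex (ModuleCat.{u} S) ℤ}
    (h : ∀ n, ¬ IsZero (P.homology n) → ¬ IsZero (Q.homology (n + 1))) :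
    hsup P + 1 ≤ hsup Q := by
  rw [← ereal_le_sub_one_iff]
  refine sSup_le ?_
  rintro s ⟨i, hi, rfl⟩
  rw [ereal_le_sub_one_iff]
  refine le_sSup ⟨i + 1, h i hi, ?_⟩
  push_cast
  rfl

lemma qpd_eq_of_not_acyclic {M : ChainComplex (ModuleCat.{u} R) ℤ} (h : ¬ M.Acyclic) :
    qpd M = sInf {s | ∃ P : ChainComplex (ModuleCat.{u} R) ℤ,
      BoundedAbove P ∧ IsQuasiProjectiveResolution P M ∧ s = csup P - hsup P} :=
  if_neg h

/-- Base change along `R → R / (x)` of a quasi-projective resolution. -/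
lemma IsQuasiProjectiveResolution.extend (hφ : Function.Surjective φ) {x : R}
    (hx : RingHom.ker φ = Ideal.span {x}) (hreg : IsSMulRegular R x)
    {N : ChainComplex (ModuleCat.{u} S) ℤ} (hb : HomologicallyBounded N)
    (hsplit : HomologySplits (restrict φ N)) {P : ChainComplex (ModuleCat.{u} R) ℤ}
    (hP : IsQuasiProjectiveResolution P (restrict φ N)) :
    IsQuasiProjectiveResolution (extend φ P) N ∧ hsup P + 1 ≤ hsup (extend φ P) := by
  obtain ⟨hsp, l, a, hl, ⟨i₀, hi₀⟩, ha⟩ := hP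
  have hx0 : φ x = 0 := by
    rw [← RingHom.mem_ker, hx]
    exact Ideal.mem_span_singleton_self x
  let e (n : ℤ) : P.homology n ≅ gradedSum (gradedHomology (restrict φ N)) a n :=
    (ha n).some.toModuleIso
  -- `H_n(P)` is isomorphic to the restriction of an `S`-module, where `x` acts as zero.
  have h0 (n : ℤ) (y : P.homology n) : x • y = 0 := by
    let e' := (e n ≪≫ (gradedSumHomologyRestrict φ N a n).symm).toLinearEquiv
    apply e'.injective
    rw [map_smul, map_zero]
    change φ x • (show gradedSum (gradedHomology N) a n from e' y) = 0
    rw [hx0, zero_smul]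
  have hse := mulShortComplex_shortExact φ hφ hx hreg hx0 hsp
  have hT := homologyShortComplex_shortExact φ hse h0
  have hbR : HomologicallyBounded (restrict φ N) := hb.restrict
  -- `a i` counts the copies from `H_n(P)` and `a (i - 1)` those from `H_{n-1}(P)`; the lower bound
  -- `l` survives.
  refine ⟨⟨hsp.extend φ, l, fun i => a i + a (i - 1), fun i hi => ?_, ⟨i₀, by
    change a i₀ + a (i₀ - 1) ≠ 0
    omega⟩,
    fun n => ?_⟩, ?_⟩
  · change a i + a (i - 1) = 0
    rw [hl i hi, hl (i - 1) (by omega)]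
  · obtain ⟨s, hs⟩ := hsplit _ (hT n) (isHomologyRetract_of_iso hbR (e n))
      (isHomologyRetract_of_iso hbR (e (n - 1)))
    have := (hT n).mono_f
    let σ := ShortComplex.Splitting.ofExactOfSection _ (hT n).exact s hs this
    refine homology_extend_equiv hφ ?_
    exact σ.isoBinaryBiproduct ≪≫ ModuleCat.biprodIsoProd _ _ ≪≫
      (((e n).toLinearEquiv.prodCongr (e (n - 1)).toLinearEquiv).trans
        (gradedSumProd _ a n)).toModuleIso
  -- `H_{n+1}(S ⊗ P)` surjects onto `H_n(P)`.
  · refine hsup_add_one_le fun n hn hz => hn ?_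
    have hz' := (isZero_restrict_homology_iff φ _ (n + 1)).2 hz
    have := (hT (n + 1)).epi_g
    have h := IsZero.of_epi (homologyShortComplex φ hse (n + 1)).g hz'
    rwa [show n = n + 1 - 1 by omega]

lemma qpd_le_qpd_restrict_sub_one (hφ : Function.Surjective φ) {x : R}
    (hx : RingHom.ker φ = Ideal.span {x}) (hreg : IsSMulRegular R x)
    {N : ChainComplex (ModuleCat.{u} S) ℤ} (hb : HomologicallyBounded N) (hN : ¬ N.Acyclic)
    (hsplit : HomologySplits (restrict φ N)) : qpd N ≤ qpd (restrict φ N) - 1 := by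
  rw [ereal_le_sub_one_iff, qpd_eq_of_not_acyclic hN,
    qpd_eq_of_not_acyclic (mt (restrict_acyclic_iff φ N).1 hN)]
  refine le_sInf ?_
  rintro s ⟨P, hPb, hP, rfl⟩
  obtain ⟨hQ, hs⟩ := hP.extend hφ hx hreg hb hsplit
  rw [← ereal_le_sub_one_iff]
  refine le_trans (b := csup (extend φ P) - hsup (extend φ P))
    (sInf_le (by exact ⟨extend φ P, hPb.extend, hQ, rfl⟩))
    ((EReal.sub_le_sub (csup_extend_le P) hs).trans (ereal_sub_add_coe _ _ 1).le)

lemma qpd_le_qpd_restrict_of_bijective (hφ : Function.Bijective φ)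
    {N : ChainComplex (ModuleCat.{u} S) ℤ} (hN : ¬ N.Acyclic) :
    qpd N ≤ qpd (restrict φ N) := by
  rw [qpd_eq_of_not_acyclic hN, qpd_eq_of_not_acyclic (mt (restrict_acyclic_iff φ N).1 hN)]
  refine le_sInf ?_
  rintro s ⟨P, hPb, ⟨hsp, l, a, hl, hne, ha⟩, rfl⟩
  have := isIso_extendUnit φ hφ P
  let u (n : ℤ) : P.homology n ≅ (restrict φ (extend φ P)).homology n :=
    (HomologicalComplex.homologyFunctor _ _ n).mapIso (asIso (extendUnit φ P))
  have hQ : IsQuasiProjectiveResolution (extend φ P) N :=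
    ⟨hsp.extend φ, l, a, hl, hne, fun n =>
      homology_extend_equiv hφ.2 ((u n).symm ≪≫ (ha n).some.toModuleIso)⟩
  refine le_trans (b := csup (extend φ P) - hsup (extend φ P))
    (sInf_le (by exact ⟨extend φ P, hPb.extend, hQ, rfl⟩))
    (EReal.sub_le_sub (csup_extend_le P) (sSup_le_sSup ?_))
  rintro s ⟨i, hi, rfl⟩
  exact ⟨i, fun h => hi ((u i).isZero_iff.2 ((isZero_restrict_homology_iff φ _ i).2 h)), rfl⟩

end ChangeOfRings

/-! ### Induction on the length of the sequence. -/

open RingTheory.Sequence in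
lemma qpd_le_qpd_restrict_sub_length {R S : Type u} [CommRing R] [CommRing S] (xs : List R)
    (hxs : IsWeaklyRegular R xs) (φ : R →+* S) (hφ : Function.Surjective φ)
    (hker : RingHom.ker φ = Ideal.ofList xs) {N : ChainComplex (ModuleCat.{u} S) ℤ}
    (hb : HomologicallyBounded N) (hN : ¬ N.Acyclic) (hsplit : HomologySplits (restrict φ N)) :
    qpd N ≤ qpd (restrict φ N) - ((xs.length : ℝ) : EReal) := by
  -- Allowing any surjection with kernel `(xs)` keeps `S` and `N` fixed while `R` becomes `R ⧸ (x)`;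
  -- no iterated quotient has to be identified with `R ⧸ (xs)`.
  induction hn : xs.length generalizing R with
  | zero =>
    obtain rfl := List.length_eq_zero_iff.1 hn
    have := qpd_le_qpd_restrict_of_bijective
      ⟨(RingHom.injective_iff_ker_eq_bot φ).2 (hker.trans Ideal.ofList_nil), hφ⟩ hN
    simpa using this
  | succ d ih =>
    obtain ⟨x, ys, rfl⟩ := List.exists_cons_of_length_eq_add_one hn
    obtain ⟨hx, hys⟩ := (isWeaklyRegular_cons_iff R x ys).1 hxs
    let π := Ideal.Quotient.mk (Ideal.span {x})
    have hxφ : ∀ r ∈ Ideal.span {x}, φ r = 0 := fun r hr => by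
      rw [← RingHom.mem_ker, hker, Ideal.ofList_cons]
      exact Ideal.mem_sup_left hr
    let ψ : R ⧸ Ideal.span {x} →+* S := Ideal.Quotient.lift _ φ hxφ
    have hψ : restrict π (restrict ψ N) = restrict φ N := rfl
    have hψs : Function.Surjective ψ := Ideal.Quotient.lift_surjective_of_surjective _ hxφ hφ
    rw [← hψ] at hsplit ⊢
    have hπ : Function.Surjective π := Ideal.Quotient.mk_surjective
    have h₁ := qpd_le_qpd_restrict_sub_one hπ (Ideal.mk_ker (I := Ideal.span {x})) hx
      (hb.restrict (φ := ψ)) (mt (restrict_acyclic_iff ψ N).1 hN) hsplit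
    -- Regularity of `ys` on the `R`-module `R/xR` is transferred to regularity of their images over
    -- the ring `R ⧸ (x)`.
    have hreg : IsWeaklyRegular (R ⧸ Ideal.span {x}) (ys.map π) := by
      refine (isWeaklyRegular_map_algebraMap_iff _ _ ys).2 ?_
      refine ((Submodule.quotEquivOfEq _ _ ?_).isWeaklyRegular_congr ys).1 hys
      ext r
      simp [Submodule.mem_smul_pointwise_iff_exists, Ideal.mem_span_singleton', mul_comm]
    have hkerψ : RingHom.ker ψ = Ideal.ofList (ys.map π) := by
      have hx0 : π x = 0 := Ideal.Quotient.eq_zero_iff_mem.2 (Ideal.mem_span_singleton_self x)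
      rw [show RingHom.ker ψ = _ from Ideal.ker_quotient_lift φ hxφ, hker, Ideal.map_ofList, List.map_cons, Ideal.ofList_cons]
      simp [π, hx0]
    have h₂ := ih (ys.map π) hreg ψ hψs hkerψ (hsplit.of_restrict hπ)
      (by simpa using hn)
    refine h₂.trans ((EReal.sub_le_sub h₁ le_rfl).trans (le_of_eq ?_))
    rw [← ereal_sub_add_coe, Nat.cast_succ, EReal.coe_add, add_comm]
    rfl

/-- Cancelling the regular element `x` in `x * b * x = x` makes `x` a unit, contradicting the
properness built into `IsRegular`. -/
lemma IsVonNeumannRegular.eq_nil_of_isRegular {R : Type u} [CommRing R]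
    (h : IsVonNeumannRegular R) {xs : List R} (hxs : RingTheory.Sequence.IsRegular R xs) :
    xs = [] := by
  rcases xs with _ | ⟨x, ys⟩
  · rfl
  · exfalso
    have hx := ((RingTheory.Sequence.isWeaklyRegular_cons_iff R x ys).1 hxs.1).1
    obtain ⟨b, hb⟩ := h x
    have hu : x * b = 1 := by
      have : x • (b * x) = x • 1 := by
        simp only [smul_eq_mul, mul_one]
        rw [← mul_assoc, hb]
      rw [mul_comm]
      exact hx this
    refine hxs.2 ?_
    have : Ideal.ofList (x :: ys) = ⊤ := Ideal.eq_top_of_isUnit_mem _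
      (Ideal.subset_span (by simp)) (IsUnit.of_mul_eq_one b hu)
    rw [this]
    simp

end
end QPD

theorem mainTheorem3 {R : Type u} [CommRing R] (xs : List R)
    (hxs : RingTheory.Sequence.IsRegular R xs)
    (M : ChainComplex (ModuleCat.{u} (R ⧸ Ideal.ofList xs)) ℤ)
    (hbdd : QPD.HomologicallyBounded M) (hM : ¬ M.Acyclic)
    (hfin : QPD.qpd (QPD.restrict (Ideal.Quotient.mk (Ideal.ofList xs)) M) < ⊤)
    (h : QPD.IsVonNeumannRegular R ∨
      Subsingleton (CategoryTheory.Abelian.Ext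
        (QPD.totalHomology (QPD.restrict (Ideal.Quotient.mk (Ideal.ofList xs)) M))
        (QPD.totalHomology (QPD.restrict (Ideal.Quotient.mk (Ideal.ofList xs)) M)) 1)) :
    QPD.qpd M ≤ QPD.qpd (QPD.restrict (Ideal.Quotient.mk (Ideal.ofList xs)) M) -
      ((xs.length : ℝ) : EReal) := by
  rcases h with h | h
  · obtain rfl := h.eq_nil_of_isRegular hxs
    have := QPD.qpd_le_qpd_restrict_of_bijective
      (φ := Ideal.Quotient.mk (Ideal.ofList ([] : List R)))
      ⟨(RingHom.injective_iff_ker_eq_bot _).2 (Ideal.mk_ker.trans Ideal.ofList_nil),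
        Ideal.Quotient.mk_surjective⟩ hM
    simpa using this
  · exact QPD.qpd_le_qpd_restrict_sub_length xs hxs.1 _ Ideal.Quotient.mk_surjective
      Ideal.mk_ker hbdd hM (QPD.homologySplits_of_subsingleton_ext h)
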